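/- Let $t\in\mathbb{R}$ be fixed and let $w(x;t)=e^{-x^4+tx^2}$, $x\in\mathbb{R}$, be the quartic Freud weight. Let $P_n(x;t)$, $n=0,1,2,\dots$, be the monic polynomials with $\deg P_n=n$ that are orthogonal with respect to $w$, i.e. $\int_{-\infty}^{\infty}P_j(x;t)P_k(x;t)w(x;t)\,dx=h_j(t)\delta_{jk}$ with $h_j(t)>0$, and let $\beta_n(t)$ be the (uniquely determined) coefficients of their three-term recurrence relation $$xP_n(x;t)=P_{n+1}(x;t)+\beta_n(t)P_{n-1}(x;t)\quad(n\ge 1),\qquad xP_0(x;t)=P_1(x;t),\qquad \beta_0(t)=0.$$ These coefficients exist and are unique, and, as $n\to\infty$, $$\beta_n(t)=\frac{n^{1/2}}{2\sqrt3}+\frac{t}{12}+\frac{t^2}{48\sqrt3\,n^{1/2}}-\frac{t^4-48}{2304\sqrt3\,n^{3/2}}+\frac{t}{288\,n^2}+\frac{t^2(t^4-144)}{55296\sqrt3\,n^{5/2}}-\frac{t^3}{1728\,n^3}+O\big(n^{-7/2}\big),$$ where the implied constant may depend on $t$. -/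

import Mathlib

open Polynomial MeasureTheory Filter Asymptotics

/-- The quartic Freud weight `w(x; t) = exp (-x⁴ + t x²)` on the real line. -/
noncomputable def freudWeight (t x : ℝ) : ℝ :=
  Real.exp (-x ^ 4 + t * x ^ 2)

/-- `P 0, P 1, P 2, …` is the sequence of monic orthogonal polynomials, `P n` of degree `n`, for
the quartic Freud weight; `h j > 0` is the squared `L²`-norm of `P j`. -/
structure IsMonicFreudPolynomials (t : ℝ) (P : ℕ → ℝ[X]) : Prop where
  monic : ∀ n, (P n).Monic
  natDegree_eq : ∀ n, (P n).natDegree = n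
  orthogonal : ∃ h : ℕ → ℝ, (∀ j, 0 < h j) ∧
    ∀ j k, ∫ x : ℝ, (P j).eval x * (P k).eval x * freudWeight t x = if j = k then h j else 0

/-- `β` is the sequence of recurrence coefficients of the monic orthogonal polynomials of the
quartic Freud weight: `x P₀ = P₁` with `β₀ = 0`, and `x Pₙ = Pₙ₊₁ + βₙ Pₙ₋₁` for `n ≥ 1`
(written with `n + 1` in place of `n`). -/
def IsFreudRecurrenceCoeff (t : ℝ) (β : ℕ → ℝ) : Prop :=
  ∃ P : ℕ → ℝ[X], IsMonicFreudPolynomials t P ∧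
    β 0 = 0 ∧ X * P 0 = P 1 ∧
    ∀ n, X * P (n + 1) = P (n + 2) + C (β (n + 1)) * P n

open scoped Topology

/-! ### The moment functional of the quartic Freud weight -/

/-! Everything rests on the string equation `4 βₙ (βₙ₋₁ + βₙ + βₙ₊₁) - 2 t βₙ = n` with `βₙ > 0`
(`pos_and_string_equation`), which is integration by parts applied to `Pₙ₋₁ Pₙ`. Comparing limsup
and liminf of `βₙ / √n` in it gives `βₙ ~ √(n/12)` (`tendsto_div_sqrt_of_string_equation`).

The truncated series `f` solves the same equation up to `O(n⁻³)` (`isBigO_freudApprox_residual`).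
Subtracting the two equations gives a linear relation for `e = β - f`: the coefficient of `eₙ` is
about `16 √(n/12)`, that of each neighbour about `4 √(n/12)`. The neighbours thus enter with total
weight about `1/2 < 1`, and a discrete maximum principle bounds `e` by residual over coefficient,
`n⁻³ / n^(1/2) = n^(-7/2)`. No expansion of `β` has to be known to exist beforehand.

Existence comes from building the polynomials by their recurrence, uniqueness from positive
definiteness of the moment functional. -/

lemma freudWeight_pos (t x : ℝ) : 0 < freudWeight t x := Real.exp_pos _

lemma continuous_freudWeight (t : ℝ) : Continuous (freudWeight t) := by
  unfold freudWeight; fun_prop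

lemma freudWeight_le (t x : ℝ) :
    freudWeight t x ≤ Real.exp ((t + 1) ^ 2 / 4) * Real.exp (-1 * x ^ 2) := by
  rw [← Real.exp_add]
  exact Real.exp_le_exp.2 (by nlinarith [sq_nonneg (x ^ 2 - (t + 1) / 2)])

lemma integrable_pow_mul_freudWeight (t : ℝ) (k : ℕ) :
    Integrable fun x : ℝ => x ^ k * freudWeight t x := by
  have hg : Integrable fun x : ℝ =>
      Real.exp ((t + 1) ^ 2 / 4) * (x ^ k * Real.exp (-1 * x ^ 2)) := by
    have := integrable_rpow_mul_exp_neg_mul_sq (b := 1) one_pos (s := k)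
      (by have : (0 : ℝ) ≤ k := k.cast_nonneg
          linarith)
    simp only [Real.rpow_natCast] at this
    exact this.const_mul _
  refine hg.mono (by have := continuous_freudWeight t; fun_prop) (.of_forall fun x => ?_)
  simp only [norm_mul, Real.norm_eq_abs, Real.abs_exp, abs_of_pos (freudWeight_pos t x)]
  calc |x ^ k| * freudWeight t x
      ≤ |x ^ k| * (Real.exp ((t + 1) ^ 2 / 4) * Real.exp (-1 * x ^ 2)) := by
        gcongr; exact freudWeight_le t x
    _ = _ := by ring

lemma integrable_eval_mul_freudWeight (t : ℝ) (p : ℝ[X]) :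
    Integrable fun x : ℝ => p.eval x * freudWeight t x := by
  induction p using Polynomial.induction_on' with
  | add p q hp hq =>
    simp only [eval_add, add_mul]
    exact hp.add hq
  | monomial n a =>
    simpa only [eval_monomial, mul_assoc] using (integrable_pow_mul_freudWeight t n).const_mul a

/-- The moment functional `p ↦ ∫ p w` of the quartic Freud weight. -/
noncomputable def freudFunctional (t : ℝ) : ℝ[X] →ₗ[ℝ] ℝ where
  toFun p := ∫ x : ℝ, p.eval x * freudWeight t x
  map_add' p q := by
    simp only [eval_add, add_mul]
    exact integral_add (integrable_eval_mul_freudWeight t p) (integrable_eval_mul_freudWeight t q)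
  map_smul' c p := by
    simp only [eval_smul, smul_eq_mul, mul_assoc, RingHom.id_apply]
    exact integral_const_mul _ _

lemma freudFunctional_apply (t : ℝ) (p : ℝ[X]) :
    freudFunctional t p = ∫ x : ℝ, p.eval x * freudWeight t x := rfl

lemma freudFunctional_C_mul (t c : ℝ) (p : ℝ[X]) :
    freudFunctional t (C c * p) = c * freudFunctional t p := by
  rw [← smul_eq_C_mul, map_smul, smul_eq_mul]

/-- The integrand is nonnegative and its support is the open set where `p` does not vanish, which is
nonempty. -/
lemma freudFunctional_mul_self_pos (t : ℝ) {p : ℝ[X]} (hp : p ≠ 0) :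
    0 < freudFunctional t (p * p) := by
  rw [freudFunctional_apply, integral_pos_iff_support_of_nonneg _
    (integrable_eval_mul_freudWeight t _)]
  · have hs : Function.support (fun x : ℝ => (p * p).eval x * freudWeight t x)
        = {x | p.eval x ≠ 0} := by
      ext x
      simp [(freudWeight_pos t x).ne']
    rw [hs]
    refine IsOpen.measure_pos _ (isOpen_ne_fun p.continuous continuous_const) ?_
    by_contra h
    refine hp (Polynomial.funext fun x => ?_)
    by_contra hx
    exact h ⟨x, by simpa using hx⟩
  · intro x
    simpa using mul_nonneg (mul_self_nonneg _) (freudWeight_pos t x).le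

lemma freudFunctional_comp_neg_X (t : ℝ) (p : ℝ[X]) :
    freudFunctional t (p.comp (-X)) = freudFunctional t p := by
  simp only [freudFunctional_apply]
  rw [← integral_neg_eq_self (fun x : ℝ => p.eval x * freudWeight t x)]
  simp [freudWeight, eval_comp, Even.neg_pow (by decide : Even 4)]

/-- Integration by parts against the quartic Freud weight. -/
lemma freudFunctional_derivative (t : ℝ) (p : ℝ[X]) :
    freudFunctional t (derivative p) = freudFunctional t (p * (C 4 * X ^ 3 - C (2 * t) * X)) := by
  rw [← sub_eq_zero, ← map_sub, freudFunctional_apply]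
  refine integral_eq_zero_of_hasDerivAt_of_integrable (f := fun x => p.eval x * freudWeight t x)
    (fun x => ?_) (integrable_eval_mul_freudWeight t _) (integrable_eval_mul_freudWeight t _)
  have h : HasDerivAt (fun x : ℝ => -x ^ 4 + t * x ^ 2) (-(4 * x ^ 3) + t * (2 * x)) x := by
    refine ((hasDerivAt_pow 4 x).neg.add ((hasDerivAt_pow 2 x).const_mul t)).congr_deriv ?_
    norm_num
  refine ((p.hasDerivAt x).mul h.exp).congr_deriv ?_
  simp only [freudWeight, eval_sub, eval_mul, eval_C, eval_pow, eval_X]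
  ring

/-! ### Monic orthogonal polynomials -/

lemma degree_sub_lt_of_monic {n : ℕ} {p q : ℝ[X]} (hp : p.Monic) (hq : q.Monic)
    (hpn : p.natDegree = n) (hqn : q.natDegree = n) : (p - q).degree < n := by
  rw [degree_lt_iff_coeff_zero]
  intro k hk
  rcases hk.eq_or_lt with rfl | hk
  · have h1 := hp.coeff_natDegree
    have h2 := hq.coeff_natDegree
    rw [hpn] at h1
    rw [hqn] at h2
    simp [h1, h2]
  · simp [coeff_eq_zero_of_natDegree_lt (hpn ▸ hk), coeff_eq_zero_of_natDegree_lt (hqn ▸ hk)]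

namespace IsMonicFreudPolynomials

variable {t : ℝ} {P Q : ℕ → ℝ[X]}

lemma freudFunctional_mul_eq_zero (hP : IsMonicFreudPolynomials t P) {j k : ℕ} (hjk : j ≠ k) :
    freudFunctional t (P j * P k) = 0 := by
  obtain ⟨h, -, ho⟩ := hP.orthogonal
  simpa [freudFunctional_apply, hjk] using ho j k

lemma norm_pos (hP : IsMonicFreudPolynomials t P) (n : ℕ) :
    0 < freudFunctional t (P n * P n) :=
  freudFunctional_mul_self_pos t (hP.monic n).ne_zero

lemma of_freudFunctional (hm : ∀ n, (P n).Monic) (hd : ∀ n, (P n).natDegree = n)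
    (ho : ∀ j k, j < k → freudFunctional t (P k * P j) = 0) : IsMonicFreudPolynomials t P := by
  refine ⟨hm, hd, fun j => freudFunctional t (P j * P j),
    fun j => freudFunctional_mul_self_pos t (hm j).ne_zero, fun j k => ?_⟩
  simp only [← eval_mul, ← freudFunctional_apply]
  split_ifs with h
  · rw [h]
  · rcases lt_or_gt_of_ne h with h | h
    · rw [mul_comm, ho _ _ h]
    · rw [ho _ _ h]

lemma freudFunctional_mul_of_degree_lt (hP : IsMonicFreudPolynomials t P) {n : ℕ} {p : ℝ[X]}
    (hp : p.degree < n) : freudFunctional t (P n * p) = 0 := by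
  suffices H : ∀ m ≤ n, ∀ p : ℝ[X], p.degree < m → freudFunctional t (P n * p) = 0 from
    H n le_rfl p hp
  intro m
  induction m with
  | zero =>
    intro _ p hp
    rw [degree_lt_iff_coeff_zero] at hp
    have : p = 0 := by ext k; simpa using hp k (Nat.zero_le _)
    simp [this]
  | succ m ih =>
    intro hm p hp
    -- Subtracting this multiple of `P m` kills the top coefficient; `m < n` makes the subtracted
    -- term orthogonal to `P n`.
    have hq : (p - C (p.coeff m) * P m).degree < m := by
      rw [degree_lt_iff_coeff_zero] at hp ⊢
      intro k hk
      rcases hk.eq_or_lt with rfl | hk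
      · have h1 := (hP.monic m).coeff_natDegree
        rw [hP.natDegree_eq] at h1
        simp [h1]
      · have : (P m).natDegree < k := by rwa [hP.natDegree_eq]
        simp [coeff_eq_zero_of_natDegree_lt this, hp k hk]
    have h := ih (by omega) _ hq
    rw [mul_sub, map_sub, mul_left_comm, freudFunctional_C_mul,
      hP.freudFunctional_mul_eq_zero (by omega : n ≠ m)] at h
    simpa using h

lemma freudFunctional_mul_monic (hP : IsMonicFreudPolynomials t P) {n : ℕ} {q : ℝ[X]}
    (hq : q.Monic) (hqn : q.natDegree = n) :
    freudFunctional t (P n * q) = freudFunctional t (P n * P n) := by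
  have := hP.freudFunctional_mul_of_degree_lt
    (degree_sub_lt_of_monic hq (hP.monic n) hqn (hP.natDegree_eq n))
  rwa [mul_sub, map_sub, sub_eq_zero] at this

/-- The difference `P n - Q n` has degree below `n`, so it is orthogonal to both `P n` and `Q n`,
hence to itself. -/
lemma unique (hP : IsMonicFreudPolynomials t P) (hQ : IsMonicFreudPolynomials t Q) (n : ℕ) :
    P n = Q n := by
  have hd := degree_sub_lt_of_monic (hP.monic n) (hQ.monic n) (hP.natDegree_eq n)
    (hQ.natDegree_eq n)
  by_contra hne
  have h := freudFunctional_mul_self_pos t (sub_ne_zero.2 hne)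
  rw [sub_mul, map_sub, hP.freudFunctional_mul_of_degree_lt hd,
    hQ.freudFunctional_mul_of_degree_lt hd, sub_zero] at h
  exact h.ne' rfl

end IsMonicFreudPolynomials

/-- The monic orthogonal polynomials of the quartic Freud weight, built from their three-term
recurrence. -/
noncomputable def freudPolynomial (t : ℝ) : ℕ → ℝ[X]
  | 0 => 1
  | 1 => X
  | n + 2 => X * freudPolynomial t (n + 1) -
      C (freudFunctional t (freudPolynomial t (n + 1) * freudPolynomial t (n + 1)) /
        freudFunctional t (freudPolynomial t n * freudPolynomial t n)) * freudPolynomial t n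

/-- The recurrence coefficients `hₙ / hₙ₋₁`. -/
noncomputable def freudCoeff (t : ℝ) : ℕ → ℝ
  | 0 => 0
  | n + 1 => freudFunctional t (freudPolynomial t (n + 1) * freudPolynomial t (n + 1)) /
        freudFunctional t (freudPolynomial t n * freudPolynomial t n)

lemma X_mul_freudPolynomial (t : ℝ) (n : ℕ) :
    X * freudPolynomial t (n + 1) =
      freudPolynomial t (n + 2) + C (freudCoeff t (n + 1)) * freudPolynomial t n := by
  rw [freudPolynomial, freudCoeff]
  ring

lemma freudPolynomial_monic_natDegree (t : ℝ) (n : ℕ) :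
    (freudPolynomial t n).Monic ∧ (freudPolynomial t n).natDegree = n := by
  induction n using Nat.strong_induction_on with
  | _ n ih =>
    match n with
    | 0 => simp [freudPolynomial]
    | 1 => simp [freudPolynomial, monic_X]
    | n + 2 =>
      obtain ⟨m1, d1⟩ := ih (n + 1) (by omega)
      obtain ⟨m0, d0⟩ := ih n (by omega)
      have hm : (X * freudPolynomial t (n + 1)).Monic := monic_X.mul m1
      have hd : (X * freudPolynomial t (n + 1)).natDegree = n + 2 := by
        rw [monic_X.natDegree_mul m1, natDegree_X, d1]; omega
      rw [freudPolynomial]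
      set c := freudFunctional t (freudPolynomial t (n + 1) * freudPolynomial t (n + 1)) /
        freudFunctional t (freudPolynomial t n * freudPolynomial t n)
      have hlt : (C c * freudPolynomial t n).natDegree
          < (X * freudPolynomial t (n + 1)).natDegree := by
        rw [hd]
        exact (natDegree_C_mul_le _ _).trans_lt (by omega)
      exact ⟨hm.sub_of_left (degree_lt_degree hlt),
        (natDegree_sub_eq_left_of_natDegree_lt hlt).trans hd⟩

lemma freudPolynomial_comp_neg_X (t : ℝ) (n : ℕ) :
    (freudPolynomial t n).comp (-X) = (-1) ^ n * freudPolynomial t n := by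
  induction n using Nat.strong_induction_on with
  | _ n ih =>
    match n with
    | 0 => simp [freudPolynomial]
    | 1 => simp [freudPolynomial]
    | n + 2 =>
      rw [freudPolynomial, sub_comp, mul_comp, mul_comp, ih (n + 1) (by omega), ih n (by omega),
        X_comp, C_comp]
      ring

lemma freudFunctional_X_mul_freudPolynomial_sq (t : ℝ) (n : ℕ) :
    freudFunctional t (X * freudPolynomial t n * freudPolynomial t n) = 0 := by
  have h := freudFunctional_comp_neg_X t (X * freudPolynomial t n * freudPolynomial t n)
  have e : (X * freudPolynomial t n * freudPolynomial t n).comp (-X) =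
      -(X * freudPolynomial t n * freudPolynomial t n) := by
    simp only [mul_comp, X_comp, freudPolynomial_comp_neg_X]
    have : ((-1 : ℝ[X]) ^ n) * (-1) ^ n = 1 := by rw [← mul_pow]; simp
    linear_combination (-X * freudPolynomial t n * freudPolynomial t n) * this
  rw [e, map_neg] at h
  linarith

/-- Strong induction on `k = n + 2`, moving `X` onto the other factor. Only two indices are
delicate: `j = n + 1` vanishes by parity, and `j = n` by the choice of the coefficient `hₙ₊₁ / hₙ`.
-/
lemma freudFunctional_freudPolynomial_mul (t : ℝ) :
    ∀ k j, j < k → freudFunctional t (freudPolynomial t k * freudPolynomial t j) = 0 := by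
  intro k
  induction k using Nat.strong_induction_on with
  | _ k ih =>
    match k with
    | 0 => intro j hj; omega
    | 1 =>
      intro j hj
      obtain rfl : j = 0 := by omega
      simpa [freudPolynomial] using freudFunctional_X_mul_freudPolynomial_sq t 0
    | n + 2 =>
      intro j hj
      have hrec : freudFunctional t (freudPolynomial t (n + 2) * freudPolynomial t j) =
          freudFunctional t (X * freudPolynomial t (n + 1) * freudPolynomial t j) -
          freudCoeff t (n + 1) * freudFunctional t (freudPolynomial t n * freudPolynomial t j) := by
        rw [← freudFunctional_C_mul, ← map_sub]
        congr 1
        linear_combination (-freudPolynomial t j) * X_mul_freudPolynomial t n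
      have hn := freudFunctional_mul_self_pos t (freudPolynomial_monic_natDegree t n).1.ne_zero
      rw [hrec]
      match j with
      | 0 =>
        have e : freudFunctional t (X * freudPolynomial t (n + 1) * freudPolynomial t 0) =
            freudFunctional t (freudPolynomial t (n + 1) * freudPolynomial t 1) := by
          congr 1; simp only [freudPolynomial]; ring
        rw [e]
        rcases Nat.eq_zero_or_pos n with rfl | hn0
        · rw [freudCoeff, div_mul_cancel₀ _ hn.ne', sub_self]
        · rw [ih (n + 1) (by omega) 1 (by omega), ih n (by omega) 0 hn0]; simp
      | i + 1 =>
        rcases (show i = n ∨ i < n by omega) with rfl | hi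
        · rw [freudFunctional_X_mul_freudPolynomial_sq, mul_comm (freudPolynomial t i),
            ih (i + 1) (by omega) i (by omega)]
          simp
        · have e : freudFunctional t (X * freudPolynomial t (n + 1) * freudPolynomial t (i + 1)) =
              freudFunctional t (freudPolynomial t (n + 1) * freudPolynomial t (i + 2)) +
              freudCoeff t (i + 1) *
                freudFunctional t (freudPolynomial t (n + 1) * freudPolynomial t i) := by
            rw [← freudFunctional_C_mul, ← map_add]
            congr 1
            linear_combination (freudPolynomial t (n + 1)) * X_mul_freudPolynomial t i
          rw [e, ih (n + 1) (by omega) i (by omega)]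
          rcases (show i + 1 = n ∨ i + 1 < n by omega) with rfl | hi'
          · rw [freudCoeff.eq_2 t (i + 1), div_mul_cancel₀ _ hn.ne']
            simp
          · rw [ih (n + 1) (by omega) (i + 2) (by omega), ih n (by omega) (i + 1) hi']
            simp

lemma isMonicFreudPolynomials_freudPolynomial (t : ℝ) :
    IsMonicFreudPolynomials t (freudPolynomial t) :=
  .of_freudFunctional (fun n => (freudPolynomial_monic_natDegree t n).1)
    (fun n => (freudPolynomial_monic_natDegree t n).2)
    fun j k h => freudFunctional_freudPolynomial_mul t k j h

lemma isFreudRecurrenceCoeff_freudCoeff (t : ℝ) : IsFreudRecurrenceCoeff t (freudCoeff t) :=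
  ⟨freudPolynomial t, isMonicFreudPolynomials_freudPolynomial t, rfl, by simp [freudPolynomial],
    X_mul_freudPolynomial t⟩

lemma IsFreudRecurrenceCoeff.unique {t : ℝ} {β γ : ℕ → ℝ} (hβ : IsFreudRecurrenceCoeff t β)
    (hγ : IsFreudRecurrenceCoeff t γ) : β = γ := by
  obtain ⟨P, hP, b0, -, hr⟩ := hβ
  obtain ⟨Q, hQ, c0, -, hs⟩ := hγ
  obtain rfl : P = Q := funext fun n => hP.unique hQ n
  funext n
  cases n with
  | zero => rw [b0, c0]
  | succ n =>
    have h := (hr n).symm.trans (hs n)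
    exact C_injective (mul_right_cancel₀ (hP.monic n).ne_zero (add_left_cancel h))

/-! ### The string equation -/

namespace IsFreudRecurrenceCoeff

variable {t : ℝ} {β : ℕ → ℝ}

/-- With `hₙ = L (Pₙ²)`, positivity is `βₙ₊₁ = hₙ₊₁ / hₙ`. For the equation, integrate `(Pₙ Pₙ₊₁)'`
by parts and express each term as a multiple of `hₙ` through the recurrence. -/
lemma pos_and_string_equation (hβ : IsFreudRecurrenceCoeff t β) (n : ℕ) :
    0 < β (n + 1) ∧
      4 * β (n + 1) * (β n + β (n + 1) + β (n + 2)) - 2 * t * β (n + 1) = n + 1 := by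
  obtain ⟨P, hP, b0, hX, hr⟩ := hβ
  have hpos := hP.norm_pos
  set L := freudFunctional t with hL
  have hmul : ∀ n, (X * P n).Monic ∧ (X * P n).natDegree = n + 1 := fun n =>
    ⟨monic_X.mul (hP.monic n), by
      rw [monic_X.natDegree_mul (hP.monic n), natDegree_X, hP.natDegree_eq, add_comm]⟩
  have hh : ∀ n, L (P (n + 1) * P (n + 1)) = β (n + 1) * L (P n * P n) := fun n => by
    have h1 := hP.freudFunctional_mul_monic (hmul n).1 (hmul n).2
    have h2 : P (n + 1) * (X * P n) = P (n + 2) * P n + C (β (n + 1)) * (P n * P n) := by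
      linear_combination (P n) * hr n
    rw [h2, map_add, freudFunctional_C_mul,
      hP.freudFunctional_mul_eq_zero (by omega : n + 2 ≠ n), zero_add] at h1
    exact h1.symm
  have hXX : L ((X * P n) * (X * P n)) = (β (n + 1) + β n) * L (P n * P n) := by
    cases n with
    | zero => rw [hX, hh 0, b0, add_zero]
    | succ n =>
      have e : (X * P (n + 1)) * (X * P (n + 1)) = P (n + 2) * P (n + 2)
          + C (2 * β (n + 1)) * (P (n + 2) * P n)
          + C (β (n + 1) * β (n + 1)) * (P n * P n) := by
        rw [hr n]; simp only [C_mul, map_ofNat]; ring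
      rw [e, map_add, map_add, freudFunctional_C_mul, freudFunctional_C_mul,
        hP.freudFunctional_mul_eq_zero (by omega : n + 2 ≠ n), ← hL, hh (n + 1), hh n]
      ring
  have hcube : L (P n * P (n + 1) * X ^ 3)
      = β (n + 1) * (β n + β (n + 1) + β (n + 2)) * L (P n * P n) := by
    have e : P n * P (n + 1) * X ^ 3 = P (n + 2) * (X * (X * P n))
        + C (β (n + 1)) * ((X * P n) * (X * P n)) := by
      linear_combination (P n * X ^ 2) * hr n
    have h1 := hP.freudFunctional_mul_monic (n := n + 2) (monic_X.mul (hmul n).1)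
      (by rw [monic_X.natDegree_mul (hmul n).1, natDegree_X, (hmul n).2]; omega)
    rw [e, map_add, h1, freudFunctional_C_mul, ← hL, hh (n + 1), hh n, hXX]
    ring
  have hlin : L (P n * P (n + 1) * X) = β (n + 1) * L (P n * P n) := by
    have e : P n * P (n + 1) * X = P (n + 1) * (X * P n) := by ring
    rw [e, hL, hP.freudFunctional_mul_monic (hmul n).1 (hmul n).2, ← hL, hh n]
  -- `Pₙ'` is orthogonal to `Pₙ₊₁`, and `Pₙ₊₁' = (n + 1) Pₙ +` lower degree.
  have hder : L (derivative (P n * P (n + 1))) = (n + 1) * L (P n * P n) := by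
    have h1 : L (P (n + 1) * derivative (P n)) = 0 := by
      refine hP.freudFunctional_mul_of_degree_lt ?_
      refine (degree_derivative_le).trans_lt ?_
      rw [degree_eq_natDegree (hP.monic n).ne_zero, hP.natDegree_eq]
      exact_mod_cast Nat.lt_succ_self n
    have h2 : L (P n * (derivative (P (n + 1)) - C ((n : ℝ) + 1) * P n)) = 0 := by
      refine hP.freudFunctional_mul_of_degree_lt ?_
      rw [degree_lt_iff_coeff_zero]
      intro k hk
      rw [coeff_sub, coeff_C_mul, coeff_derivative]
      rcases hk.eq_or_lt with rfl | hk
      · have c1 := (hP.monic n).coeff_natDegree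
        have c2 := (hP.monic (n + 1)).coeff_natDegree
        rw [hP.natDegree_eq] at c1 c2
        rw [c1, c2]; ring
      · rw [coeff_eq_zero_of_natDegree_lt (by rw [hP.natDegree_eq]; omega),
          coeff_eq_zero_of_natDegree_lt (by rw [hP.natDegree_eq]; omega)]
        ring
    rw [mul_sub, map_sub, mul_left_comm, freudFunctional_C_mul, sub_eq_zero] at h2
    rw [derivative_mul, map_add, mul_comm (derivative (P n)), h1, h2, zero_add]
  have hibp := freudFunctional_derivative t (P n * P (n + 1))
  have e : P n * P (n + 1) * (C 4 * X ^ 3 - C (2 * t) * X)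
      = C 4 * (P n * P (n + 1) * X ^ 3) - C (2 * t) * (P n * P (n + 1) * X) := by ring
  rw [e, map_sub, freudFunctional_C_mul, freudFunctional_C_mul, ← hL, hder, hcube, hlin] at hibp
  constructor
  · exact pos_of_mul_pos_left (hh n ▸ hpos (n + 1)) (hpos n).le
  · exact mul_right_cancel₀ (hpos n).ne' (by linear_combination -hibp)

end IsFreudRecurrenceCoeff

/-! ### Leading asymptotics -/

/-- A bounded nonnegative sequence with `4 xₙ (xₙ₋₁ + xₙ + xₙ₊₁) → 1` converges to `1 / √12`. -/
lemma tendsto_of_tendsto_mul_three_sum {x : ℕ → ℝ} {K : ℝ} (h0 : ∀ n, 0 ≤ x n)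
    (hK : ∀ n, x n ≤ K)
    (h : Tendsto (fun n => 4 * x (n + 1) * (x n + x (n + 1) + x (n + 2))) atTop (𝓝 1)) :
    Tendsto x atTop (𝓝 (1 / √12)) := by
  have hb1 : IsBoundedUnder (· ≤ ·) atTop x := isBoundedUnder_of ⟨K, hK⟩
  have hb2 : IsBoundedUnder (· ≥ ·) atTop x := isBoundedUnder_of ⟨0, h0⟩
  set A := limsup x atTop with hA
  set a := liminf x atTop with ha
  have haA : a ≤ A := liminf_le_limsup hb1 hb2
  have ha0 : 0 ≤ a := le_liminf_of_le hb1.isCoboundedUnder_ge (.of_forall h0)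
  have hε : ∀ k : ℕ, 0 < 1 / ((k : ℝ) + 1) := fun k => by positivity
  have up : ∀ k : ℕ, ∀ᶠ n in atTop, x n < A + 1 / ((k : ℝ) + 1) := fun k =>
    eventually_lt_of_limsup_lt (by have := hε k; linarith) hb1
  have lo : ∀ k : ℕ, ∀ᶠ n in atTop, a - 1 / ((k : ℝ) + 1) < x n := fun k =>
    eventually_lt_of_lt_liminf (by have := hε k; linarith) hb2
  have s1 : ∀ {p : ℕ → Prop}, (∀ᶠ n in atTop, p n) → ∀ᶠ n in atTop, p (n + 1) := fun hp =>
    (tendsto_add_atTop_nat 1).eventually hp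
  have s2 : ∀ {p : ℕ → Prop}, (∀ᶠ n in atTop, p n) → ∀ᶠ n in atTop, p (n + 2) := fun hp =>
    (tendsto_add_atTop_nat 2).eventually hp
  have f1 : ∀ {p : ℕ → Prop}, (∃ᶠ n in atTop, p n) → ∃ᶠ n in atTop, p (n + 1) := fun {p} hp => by
    rw [frequently_atTop] at hp ⊢
    intro N
    obtain ⟨m, hm, hpm⟩ := hp (N + 1)
    exact ⟨m - 1, by omega, by rwa [Nat.sub_add_cancel (by omega)]⟩
  have l0 : Tendsto (fun k : ℕ => 1 / ((k : ℝ) + 1)) atTop (𝓝 0) :=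
    tendsto_one_div_add_atTop_nhds_zero_nat
  -- Along indices where `x (n + 1)` approaches the limsup `A`, both neighbours are asymptotically
  -- at least `a`. `hj` is the mirror image, and together they give `A² ≤ a²`.
  have hi : 4 * A * (A + 2 * a) ≤ 1 := by
    have hf : ∀ k : ℕ, ∃ n, k ≤ n ∧ A - 1 / ((k : ℝ) + 1) < x (n + 1) ∧
        x (n + 1) < A + 1 / ((k : ℝ) + 1) ∧ a - 1 / ((k : ℝ) + 1) < x n ∧
        a - 1 / ((k : ℝ) + 1) < x (n + 2) := fun k => by
      have fr : ∃ᶠ n in atTop, A - 1 / ((k : ℝ) + 1) < x n :=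
        frequently_lt_of_lt_limsup hb2.isCoboundedUnder_le (by have := hε k; linarith)
      obtain ⟨n, h1, h2, h3, h4, h5⟩ := ((f1 fr).and_eventually ((eventually_ge_atTop k).and
        ((s1 (up k)).and ((lo k).and (s2 (lo k)))))).exists
      exact ⟨n, h2, h1, h3, h4, h5⟩
    choose φ hφ h1 h2 h3 h4 using hf
    have hφt : Tendsto φ atTop atTop := tendsto_atTop_mono hφ tendsto_id
    have hX : Tendsto (fun k => x (φ k + 1)) atTop (𝓝 A) := by
      refine tendsto_of_tendsto_of_tendsto_of_le_of_le ?_ ?_ (fun k => (h1 k).le)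
        (fun k => (h2 k).le)
      · simpa using l0.const_sub A
      · simpa using l0.const_add A
    have hl : Tendsto (fun k : ℕ => 4 * x (φ k + 1) *
        (x (φ k + 1) + 2 * (a - 1 / ((k : ℝ) + 1)))) atTop (𝓝 (4 * A * (A + 2 * (a - 0)))) :=
      (hX.const_mul 4).mul (hX.add ((l0.const_sub a).const_mul 2))
    rw [sub_zero] at hl
    refine le_of_tendsto_of_tendsto' hl (h.comp hφt) fun k => ?_
    have := h0 (φ k + 1)
    exact mul_le_mul_of_nonneg_left (by linarith [h3 k, h4 k]) (by linarith)
  have hj : 1 ≤ 4 * a * (a + 2 * A) := by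
    have hf : ∀ k : ℕ, ∃ n, k ≤ n ∧ a - 1 / ((k : ℝ) + 1) < x (n + 1) ∧
        x (n + 1) < a + 1 / ((k : ℝ) + 1) ∧ x n < A + 1 / ((k : ℝ) + 1) ∧
        x (n + 2) < A + 1 / ((k : ℝ) + 1) := fun k => by
      have fr : ∃ᶠ n in atTop, x n < a + 1 / ((k : ℝ) + 1) :=
        frequently_lt_of_liminf_lt hb1.isCoboundedUnder_ge (by have := hε k; linarith)
      obtain ⟨n, h1, h2, h3, h4, h5⟩ := ((f1 fr).and_eventually ((eventually_ge_atTop k).and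
        ((s1 (lo k)).and ((up k).and (s2 (up k)))))).exists
      exact ⟨n, h2, h3, h1, h4, h5⟩
    choose φ hφ h1 h2 h3 h4 using hf
    have hφt : Tendsto φ atTop atTop := tendsto_atTop_mono hφ tendsto_id
    have hX : Tendsto (fun k => x (φ k + 1)) atTop (𝓝 a) := by
      refine tendsto_of_tendsto_of_tendsto_of_le_of_le ?_ ?_ (fun k => (h1 k).le)
        (fun k => (h2 k).le)
      · simpa using l0.const_sub a
      · simpa using l0.const_add a
    have hl : Tendsto (fun k : ℕ => 4 * x (φ k + 1) *
        (x (φ k + 1) + 2 * (A + 1 / ((k : ℝ) + 1)))) atTop (𝓝 (4 * a * (a + 2 * (A + 0)))) :=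
      (hX.const_mul 4).mul (hX.add ((l0.const_add A).const_mul 2))
    rw [add_zero] at hl
    refine le_of_tendsto_of_tendsto' (h.comp hφt) hl fun k => ?_
    have := h0 (φ k + 1)
    exact mul_le_mul_of_nonneg_left (by linarith [h3 k, h4 k]) (by linarith)
  have hAa : A = a := le_antisymm (abs_le_of_sq_le_sq' (by nlinarith) ha0).2 haA
  have hval : a = 1 / √12 := by
    have h12 : a ^ 2 = 1 / 12 := by rw [hAa] at hi hj; nlinarith
    rw [← Real.sqrt_sq ha0, h12, Real.sqrt_div zero_le_one, Real.sqrt_one]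
  rw [← hval]
  exact tendsto_of_liminf_eq_limsup rfl hAa hb1 hb2

lemma tendsto_sqrt_div_sqrt_add (c d : ℝ) :
    Tendsto (fun n : ℕ => √((n : ℝ) + c) / √((n : ℝ) + d)) atTop (𝓝 1) := by
  have hd : Tendsto (fun n : ℕ => (n : ℝ) + d) atTop atTop :=
    tendsto_atTop_add_const_right _ _ tendsto_natCast_atTop_atTop
  have hr : Tendsto (fun n : ℕ => √(1 + (c - d) / ((n : ℝ) + d))) atTop (𝓝 1) := by
    have := ((hd.const_div_atTop (c - d)).const_add 1).sqrt
    simpa using this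
  refine hr.congr' ?_
  filter_upwards [hd.eventually_gt_atTop 0] with n hn
  rw [← Real.sqrt_div' _ hn.le]
  congr 1
  field_simp
  ring

/-- Leading asymptotics of the nonnegative solution of the string equation. -/
lemma tendsto_div_sqrt_of_string_equation {t : ℝ} {b : ℕ → ℝ} (hb0 : b 0 = 0)
    (hpos : ∀ n, 0 < b (n + 1))
    (hs : ∀ n : ℕ, 4 * b (n + 1) * (b n + b (n + 1) + b (n + 2)) - 2 * t * b (n + 1) = n + 1) :
    Tendsto (fun n : ℕ => b n / √n) atTop (𝓝 (1 / √12)) := by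
  have hnn : ∀ n, 0 ≤ b n := fun n => by
    cases n with
    | zero => rw [hb0]
    | succ n => exact (hpos n).le
  have hx0 : ∀ n : ℕ, 0 ≤ b n / √n := fun n => div_nonneg (hnn n) (Real.sqrt_nonneg _)
  have hbound : ∀ n : ℕ, b n / √n ≤ |t| + 1 := fun n => by
    cases n with
    | zero => simp; positivity
    | succ n =>
      have hs1 : 1 ≤ √((n + 1 : ℕ) : ℝ) := 
        Real.one_le_sqrt.2 (by push_cast; linarith [n.cast_nonneg (α := ℝ)])
      have hsq : √((n + 1 : ℕ) : ℝ) ^ 2 = n + 1 := by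
        rw [Real.sq_sqrt (by positivity)]; push_cast; rfl
      rw [div_le_iff₀ (by linarith)]
      set s := √((n + 1 : ℕ) : ℝ)
      -- If `b (n + 1) > (|t| + 1) s`, then `b (4 b - 2 t) ≥ 4 s² = 4 (n + 1)`, too large for the
      -- string equation.
      by_contra! hlt
      have ht := le_abs_self t
      have ht0 := abs_nonneg t
      have h1 : s ≤ b (n + 1) := by nlinarith
      have h2 : 4 * s ≤ 4 * b (n + 1) - 2 * t := by nlinarith
      have h3 : b (n + 1) * (4 * b (n + 1) - 2 * t) ≤ n + 1 := by
        have := mul_nonneg (hnn (n + 1)) (add_nonneg (hnn n) (hnn (n + 2)))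
        nlinarith [hs n]
      have h4 : s * (4 * s) ≤ b (n + 1) * (4 * b (n + 1) - 2 * t) :=
        mul_le_mul h1 h2 (by linarith) (hnn _)
      nlinarith
  refine tendsto_of_tendsto_mul_three_sum hx0 hbound ?_
  have z0 : Tendsto (fun n : ℕ => b (n + 0) / √((n + 0 : ℕ) : ℝ) *
      (1 - √((n : ℝ) + 0) / √((n : ℝ) + 1))) atTop (𝓝 0) :=
    bdd_le_mul_tendsto_zero' (|t| + 1)
      (.of_forall fun n => by rw [abs_of_nonneg (hx0 _)]; exact hbound _)
      (by simpa using (tendsto_sqrt_div_sqrt_add 0 1).const_sub 1)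
  have z2 : Tendsto (fun n : ℕ => b (n + 2) / √((n + 2 : ℕ) : ℝ) *
      (1 - √((n : ℝ) + 2) / √((n : ℝ) + 1))) atTop (𝓝 0) :=
    bdd_le_mul_tendsto_zero' (|t| + 1)
      (.of_forall fun n => by rw [abs_of_nonneg (hx0 _)]; exact hbound _)
      (by simpa using (tendsto_sqrt_div_sqrt_add 2 1).const_sub 1)
  have zt : Tendsto (fun n : ℕ => 2 * t / √((n : ℝ) + 1)) atTop (𝓝 0) :=
    (Real.tendsto_sqrt_atTop.comp
      (tendsto_atTop_add_const_right _ _ tendsto_natCast_atTop_atTop)).const_div_atTop _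
  -- After division by `n + 1`, this is exactly the deviation of `4 xₙ₊₁ (xₙ + xₙ₊₁ + xₙ₊₂)` from
  -- `1`, where `xₙ = b n / √n`.
  have zz : Tendsto (fun n : ℕ => b (n + 1) / √((n + 1 : ℕ) : ℝ) *
      (2 * t / √((n : ℝ) + 1) +
        4 * (b (n + 0) / √((n + 0 : ℕ) : ℝ) * (1 - √((n : ℝ) + 0) / √((n : ℝ) + 1)) +
          b (n + 2) / √((n + 2 : ℕ) : ℝ) * (1 - √((n : ℝ) + 2) / √((n : ℝ) + 1)))))
      atTop (𝓝 0) :=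
    bdd_le_mul_tendsto_zero' (|t| + 1)
      (.of_forall fun n => by rw [abs_of_nonneg (hx0 _)]; exact hbound _)
      (by simpa using zt.add ((z0.add z2).const_mul 4))
  have := zz.const_add 1
  rw [add_zero] at this
  refine this.congr fun n => ?_
  have e0 : b n / √(n : ℝ) * √(n : ℝ) = b n := by
    cases n with
    | zero => simp [hb0]
    | succ n => rw [div_mul_cancel₀]; positivity
  have p1 : √((n : ℝ) + 1) ≠ 0 := by positivity
  have p2 : √((n : ℝ) + 2) ≠ 0 := by positivity
  have q1 : √((n : ℝ) + 1) ^ 2 = n + 1 := Real.sq_sqrt (by positivity)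
  have h := hs n
  rw [← e0] at h
  push_cast
  simp only [add_zero]
  set y := b n / √(n : ℝ)
  rw [← q1] at h
  field_simp
  linear_combination (-√((n : ℝ) + 2)) * h

/-! ### A discrete comparison principle -/

/-- If `uₙ₊₁ ≤ θ (uₙ + uₙ₊₂) + K` with `θ = 7/20` and `u` grows more slowly than `2 ^ n`, then `u`
is bounded above. -/
lemma exists_upper_bound_of_le_mul_neighbors {u : ℕ → ℝ} {N : ℕ} {K : ℝ}
    (hu : ∀ n ≥ N, u (n + 1) ≤ 7 / 20 * (u n + u (n + 2)) + K)
    (hg : u =o[atTop] fun n : ℕ => (2 : ℝ) ^ n) : ∃ M, ∀ n ≥ N, u n ≤ M := by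
  -- The factor `10/3` gives `7/10 * M + K ≤ M`, so the constant `M` is a supersolution.
  set M := max (max (u N) 0) (10 / 3 * K)
  have hM1 : u N ≤ M := (le_max_left _ _).trans (le_max_left _ _)
  have hM0 : 0 ≤ M := (le_max_right _ _).trans (le_max_left _ _)
  have hMK : 10 / 3 * K ≤ M := le_max_right _ _
  refine ⟨M, ?_⟩
  -- The penalty `ε 2ⁿ` forces a maximum over a finite range. It is a strict supersolution, since
  -- `7/20 * (1 + 4) < 2`, so a positive interior maximum is impossible.
  have key : ∀ ε > 0, ∀ n ≥ N, u n ≤ M + ε * 2 ^ n := by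
    intro ε hε n hn
    obtain ⟨T, hT⟩ := eventually_atTop.1 (hg.bound hε)
    have hfar : ∀ m ≥ T, u m ≤ M + ε * 2 ^ m := fun m hm => by
      have := (le_abs_self _).trans (hT m hm)
      rw [Real.norm_of_nonneg (by positivity)] at this
      linarith
    obtain ⟨m, hm, hmax⟩ := Finset.exists_max_image (Finset.Icc N (max n T))
      (fun m => u m - (M + ε * 2 ^ m)) ⟨n, Finset.mem_Icc.2 ⟨hn, le_max_left _ _⟩⟩
    have hnm := hmax n (Finset.mem_Icc.2 ⟨hn, le_max_left _ _⟩)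
    suffices u m - (M + ε * 2 ^ m) ≤ 0 by linarith
    rw [Finset.mem_Icc] at hm
    by_contra! hd
    have hmN : m ≠ N := by
      rintro rfl
      have : 0 < ε * 2 ^ m := by positivity
      linarith
    have hmT : m < T := by
      by_contra! h
      linarith [hfar m h]
    obtain ⟨k, rfl⟩ : ∃ k, m = k + 1 := ⟨m - 1, by omega⟩
    have h1 := hmax k (Finset.mem_Icc.2 ⟨by omega, by omega⟩)
    have h2 := hmax (k + 2) (Finset.mem_Icc.2 ⟨by omega, by omega⟩)
    have h3 := hu k (by omega)
    have h4 : 0 < ε * 2 ^ k := by positivity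
    simp only [pow_succ] at h1 h2 hd
    nlinarith
  intro n hn
  refine le_of_forall_pos_le_add fun δ hδ => ?_
  have := key (δ / 2 ^ n) (by positivity) n hn
  rwa [div_mul_cancel₀ _ (by positivity)] at this

lemma tendsto_natCast_add_rpow_ratio (a : ℝ) :
    Tendsto (fun n : ℕ => (((n : ℝ) + 1) / n) ^ a) atTop (𝓝 1) := by
  have h : Tendsto (fun n : ℕ => ((n : ℝ) + 1) / n) atTop (𝓝 1) := by
    have h1 : Tendsto (fun n : ℕ => 1 + 1 / (n : ℝ)) atTop (𝓝 (1 + 0)) :=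
      (tendsto_const_div_atTop_nhds_zero_nat 1).const_add 1
    rw [add_zero] at h1
    refine h1.congr' ?_
    filter_upwards [eventually_gt_atTop 0] with n hn
    have : (n : ℝ) ≠ 0 := by positivity
    field_simp
  simpa using h.rpow_const (p := a) (.inl one_ne_zero)

/-- If `|eₙ₊₁| ≤ 3/10 (|eₙ| + |eₙ₊₂|) + K (n+1)^(-a)` eventually and `e` grows at most
polynomially, then `eₙ = O(n^(-a))`. -/
lemma isBigO_rpow_of_abs_le_mul_neighbors {e : ℕ → ℝ} {a c K : ℝ} (ha : 0 ≤ a)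
    (hc : e =O[atTop] fun n : ℕ => (n : ℝ) ^ c)
    (he : ∀ᶠ n : ℕ in atTop,
      |e (n + 1)| ≤ 3 / 10 * (|e n| + |e (n + 2)|) + K * ((n : ℝ) + 1) ^ (-a)) :
    e =O[atTop] fun n : ℕ => (n : ℝ) ^ (-a) := by
  -- The weight costs a factor `((n+1)/n)^a`, eventually below `7/6`, and `3/10 * 7/6 = 7/20`.
  set u : ℕ → ℝ := fun n => |e n| * (n : ℝ) ^ a with hu
  have hrec : ∀ᶠ n : ℕ in atTop, u (n + 1) ≤ 7 / 20 * (u n + u (n + 2)) + K := by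
    filter_upwards [he, eventually_gt_atTop 0,
      (tendsto_natCast_add_rpow_ratio a).eventually_lt_const (by norm_num : (1 : ℝ) < 7 / 6)]
      with n h hn hr
    have hn' : (0 : ℝ) < n := by exact_mod_cast hn
    rw [Real.div_rpow (by positivity) hn'.le, div_lt_iff₀ (by positivity)] at hr
    have hr2 : ((n : ℝ) + 1) ^ a ≤ ((n : ℝ) + 2) ^ a :=
      Real.rpow_le_rpow (by positivity) (by linarith) ha
    have hcancel : ((n : ℝ) + 1) ^ (-a) * ((n : ℝ) + 1) ^ a = 1 := by
      rw [← Real.rpow_add (by positivity)]; simp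
    simp only [hu]
    push_cast
    have hp : 0 < ((n : ℝ) + 1) ^ a := by positivity
    have h1 := mul_le_mul_of_nonneg_right h hp.le
    have h2 := mul_le_mul_of_nonneg_left hr.le (abs_nonneg (e n))
    have h3 := mul_le_mul_of_nonneg_left hr2 (abs_nonneg (e (n + 2)))
    have h4 : 0 ≤ |e (n + 2)| * ((n : ℝ) + 2) ^ a := by positivity
    calc |e (n + 1)| * ((n : ℝ) + 1) ^ a
        ≤ (3 / 10 * (|e n| + |e (n + 2)|) + K * ((n : ℝ) + 1) ^ (-a)) * ((n : ℝ) + 1) ^ a := h1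
      _ = 3 / 10 * (|e n| * ((n : ℝ) + 1) ^ a) + 3 / 10 * (|e (n + 2)| * ((n : ℝ) + 1) ^ a)
          + K * (((n : ℝ) + 1) ^ (-a) * ((n : ℝ) + 1) ^ a) := by ring
      _ ≤ _ := by rw [hcancel]; linarith
  have hgrow : u =o[atTop] fun n : ℕ => (2 : ℝ) ^ n := by
    have h1 : u =O[atTop] fun n : ℕ => (n : ℝ) ^ (c + a) := by
      refine (hc.abs_left.mul (isBigO_refl (fun n : ℕ => (n : ℝ) ^ a) _)).congr'
        EventuallyEq.rfl ?_
      filter_upwards [eventually_gt_atTop 0] with n hn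
      rw [Real.rpow_add (by exact_mod_cast hn)]
    refine h1.trans_isLittleO ?_
    have h2 := (isLittleO_rpow_exp_pos_mul_atTop (c + a) (Real.log_pos one_lt_two)).comp_tendsto
      tendsto_natCast_atTop_atTop
    refine h2.congr_right fun n => ?_
    simp only [Function.comp]
    rw [mul_comm, Real.exp_nat_mul, Real.exp_log two_pos]
  obtain ⟨N, hN⟩ := eventually_atTop.1 hrec
  obtain ⟨M, hM⟩ := exists_upper_bound_of_le_mul_neighbors hN hgrow
  refine IsBigO.of_bound M ?_
  filter_upwards [eventually_ge_atTop N, eventually_gt_atTop 0] with n hn h0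
  have h0' : (0 : ℝ) < n := by exact_mod_cast h0
  rw [Real.norm_eq_abs, Real.norm_of_nonneg (by positivity), Real.rpow_neg h0'.le,
    ← div_eq_mul_inv, le_div_iff₀ (by positivity)]
  exact hM n hn

/-! ### Comparison with an approximate solution of the string equation -/

/-- A solution of the string equation is as close to an approximate solution as the residual
of the latter allows. -/
lemma isBigO_sub_of_string_equation_residual {t a : ℝ} {b f : ℕ → ℝ} (ha : 0 ≤ a)
    (hs : ∀ n : ℕ, 4 * b (n + 1) * (b n + b (n + 1) + b (n + 2)) - 2 * t * b (n + 1) = n + 1)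
    (hb : Tendsto (fun n : ℕ => b n / √n) atTop (𝓝 (1 / √12)))
    (hf : Tendsto (fun n : ℕ => f n / √n) atTop (𝓝 (1 / √12)))
    (hR : (fun n : ℕ => 4 * f (n + 1) * (f n + f (n + 1) + f (n + 2)) - 2 * t * f (n + 1)
      - (n + 1)) =O[atTop] fun n : ℕ => ((n : ℝ) + 1) ^ (1 / 2 - a)) :
    (fun n => b n - f n) =O[atTop] fun n : ℕ => (n : ℝ) ^ (-a) := by
  obtain ⟨K, hK⟩ := hR.bound
  refine isBigO_rpow_of_abs_le_mul_neighbors (c := 1 / 2) (K := K) ha ?_ ?_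
  · have h : ∀ g : ℕ → ℝ, Tendsto (fun n : ℕ => g n / √n) atTop (𝓝 (1 / √12)) →
        g =O[atTop] fun n : ℕ => (n : ℝ) ^ (1 / 2 : ℝ) := fun g hg => by
      have := (hg.isBigO_one ℝ).mul (isBigO_refl (fun n : ℕ => √(n : ℝ)) atTop)
      refine this.congr' ?_ (.of_forall fun n => by simp only [one_mul, Real.sqrt_eq_rpow])
      filter_upwards [eventually_gt_atTop 0] with n hn
      rw [div_mul_cancel₀]
      positivity
    exact (h b hb).sub (h f hf)
  · have shift : ∀ (g : ℕ → ℝ) (m : ℕ), Tendsto (fun n : ℕ => g n / √n) atTop (𝓝 (1 / √12)) →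
        Tendsto (fun n : ℕ => g (n + m) / √((n : ℝ) + 1)) atTop (𝓝 (1 / √12)) :=
      fun g m hg => by
        have h1 := (hg.comp (tendsto_add_atTop_nat m)).mul (tendsto_sqrt_div_sqrt_add m 1)
        rw [mul_one] at h1
        refine h1.congr' ?_
        filter_upwards [eventually_gt_atTop 0] with n hn
        simp only [Function.comp]
        push_cast
        have : √((n : ℝ) + m) ≠ 0 := by positivity
        field_simp
    set s : ℝ := 1 / √12 with hsdef
    have hs1 : 1 / 4 < s := by
      rw [hsdef]
      apply one_div_lt_one_div_of_lt (by positivity)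
      rw [Real.sqrt_lt' (by norm_num)]; norm_num
    have zt : Tendsto (fun n : ℕ => 2 * t / √((n : ℝ) + 1)) atTop (𝓝 0) :=
      (Real.tendsto_sqrt_atTop.comp
        (tendsto_atTop_add_const_right _ _ tendsto_natCast_atTop_atTop)).const_div_atTop _
    have hD := ((((shift b 0 hb).add (shift b 1 hb)).add (shift b 2 hb)).add
      (shift f 1 hf)).const_mul 4 |>.sub zt
    -- The limit is `16 s`. The thresholds `15 s` here and `9/8 s` for `f` give the neighbour weight
    -- `4 * (9/8) / 15 = 3/10`.
    have hD1 := hD.eventually_const_lt (show 15 * s < _ by linarith)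
    have hF := (shift f 1 hf).eventually_lt_const (show s < 9 / 8 * s by linarith)
    have hF0 := (shift f 1 hf).eventually_const_lt (show 0 < s by linarith)
    filter_upwards [hK, hD1, hF, hF0] with n hK hD hF hF0
    have hp : 0 < √((n : ℝ) + 1) := by positivity
    have hsn := hs n
    set q := √((n : ℝ) + 1) with hq
    simp only [add_zero] at hD
    set D := 4 * (b n + b (n + 1) + b (n + 2)) + 4 * f (n + 1) - 2 * t with hDdef
    have hDq : 15 * s * q < D := by
      have : 4 * (b n / q + b (n + 1) / q + b (n + 2) / q + f (n + 1) / q) - 2 * t / q = D / q := by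
        rw [hDdef]; field_simp
      rw [this, lt_div_iff₀ hp] at hD
      exact hD
    rw [div_lt_iff₀ hp] at hF
    have hf0 : 0 < f (n + 1) := by
      have := mul_pos hF0 hp
      rwa [div_mul_cancel₀ _ hp.ne'] at this
    set R := 4 * f (n + 1) * (f n + f (n + 1) + f (n + 2)) - 2 * t * f (n + 1) - (n + 1) with hRdef
    have hRq : |R| ≤ K * (q * ((n : ℝ) + 1) ^ (-a)) := by
      rw [Real.norm_eq_abs, Real.norm_of_nonneg (by positivity), sub_eq_add_neg,
        Real.rpow_add (by positivity), ← Real.sqrt_eq_rpow] at hK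
      exact hK
    have hsq : 0 < s * q := mul_pos (by linarith) hp
    have hqs : q ≤ 4 * (s * q) := by nlinarith
    have hDpos : 0 < D := by linarith
    have hid : D * (b (n + 1) - f (n + 1)) =
        -R - 4 * f (n + 1) * ((b n - f n) + (b (n + 2) - f (n + 2))) := by
      rw [hDdef, hRdef]
      linear_combination hsn
    have habs : D * |b (n + 1) - f (n + 1)| ≤
        |R| + 4 * f (n + 1) * (|b n - f n| + |b (n + 2) - f (n + 2)|) := by
      rw [← abs_of_pos hDpos, ← abs_mul, hid]
      refine (abs_sub _ _).trans ?_
      rw [abs_neg, abs_mul, abs_of_pos (by linarith : 0 < 4 * f (n + 1))]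
      gcongr
      exact abs_add_le _ _
    have hz : 0 < ((n : ℝ) + 1) ^ (-a) := by positivity
    set z := ((n : ℝ) + 1) ^ (-a)
    set S := |b n - f n| + |b (n + 2) - f (n + 2)| with hS
    have hS0 : 0 ≤ S := by positivity
    have hK0 : 0 ≤ K := by
      have h1 := (abs_nonneg R).trans hRq
      exact nonneg_of_mul_nonneg_left h1 (by positivity)
    have h1 : 4 * f (n + 1) * S ≤ D * (3 / 10 * S) := by nlinarith
    have h2 : |R| ≤ D * (K * z) := by
      have : q ≤ D := by linarith
      nlinarith [mul_le_mul_of_nonneg_right this (mul_nonneg hK0 hz.le)]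
    refine le_of_mul_le_mul_left ?_ hDpos
    linarith

/-! ### The approximate solution -/

lemma ring_choose_two (a : ℝ) : Ring.choose a 2 = a * (a - 1) / 2 := by
  have := Ring.descPochhammer_eq_factorial_smul_choose a 2
  simp only [descPochhammer, Nat.factorial, nsmul_eq_mul] at this
  simp [smeval_mul, smeval_sub, smeval_X, smeval_one] at this
  linarith

/-- The cubic coefficient can stay unevaluated: it cancels between `u` and `-u` in the second
difference. -/
lemma isBigO_one_add_rpow_sub (a : ℝ) :
    (fun u : ℝ => (1 + u) ^ a - (1 + a * u + a * (a - 1) / 2 * u ^ 2 + Ring.choose a 3 * u ^ 3))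
      =O[𝓝 0] fun u => u ^ 4 := by
  have h := (Real.one_add_rpow_hasFPowerSeriesAt_zero (a := a)).isBigO_sub_partialSum_pow 4
  simp only [zero_add, Real.norm_eq_abs, ← abs_pow] at h
  refine h.of_abs_right.congr_left fun u => ?_
  simp [FormalMultilinearSeries.partialSum, Finset.sum_range_succ, binomialSeries,
    FormalMultilinearSeries.coeff_ofScalars, ring_choose_two]
  ring

/-- The central second difference of a real power. -/
lemma isBigO_rpow_second_difference_sub (a : ℝ) :
    (fun x : ℝ => (x + 1) ^ a + (x - 1) ^ a - 2 * x ^ a - a * (a - 1) * x ^ (a - 2))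
      =O[atTop] fun x => x ^ (a - 4) := by
  have hu : Tendsto (fun x : ℝ => x⁻¹) atTop (𝓝 0) := tendsto_inv_atTop_zero
  have h := (isBigO_one_add_rpow_sub a).comp_tendsto hu
  have h' := (isBigO_one_add_rpow_sub a).comp_tendsto (by simpa using hu.neg)
  have h2 := (isBigO_refl (fun x : ℝ => x ^ a) atTop).mul
    (h.add (h'.congr_right (g₂ := fun x : ℝ => (x⁻¹) ^ 4) fun x => by
      simp [Function.comp, Even.neg_pow (by decide : Even 4)]))
  refine h2.congr' ?_ ?_
  · filter_upwards [eventually_gt_atTop 1] with x hx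
    have hx0 : 0 < x := by linarith
    have e1 : (x + 1) ^ a = x ^ a * (1 + x⁻¹) ^ a := by
      rw [← Real.mul_rpow hx0.le (by positivity)]; congr 1; field_simp
    have e2 : (x - 1) ^ a = x ^ a * (1 + -x⁻¹) ^ a := by
      rw [← Real.mul_rpow hx0.le]
      · congr 1; field_simp; ring
      · have := inv_lt_one_of_one_lt₀ hx; linarith
    have e3 : x ^ (a - 2) = x ^ a * x⁻¹ ^ 2 := by
      rw [Real.rpow_sub hx0, div_eq_mul_inv, inv_pow]; norm_cast
    rw [e1, e2, e3]
    simp only [Function.comp]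
    ring
  · filter_upwards [eventually_gt_atTop 0] with x hx
    simp only [Function.comp]
    rw [Real.rpow_sub hx, div_eq_mul_inv, inv_pow]; norm_cast

lemma isBigO_rpow_rpow_atTop {a b : ℝ} (h : a ≤ b) :
    (fun x : ℝ => x ^ a) =O[atTop] fun x => x ^ b := by
  refine IsBigO.of_bound 1 ?_
  filter_upwards [eventually_ge_atTop 1] with x hx
  rw [one_mul, Real.norm_of_nonneg (by positivity), Real.norm_of_nonneg (by positivity)]
  exact Real.rpow_le_rpow_of_exponent_le hx h

lemma isBigO_rpow_second_difference (a : ℝ) :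
    (fun x : ℝ => (x + 1) ^ a + (x - 1) ^ a - 2 * x ^ a) =O[atTop] fun x => x ^ (a - 2) := by
  have h := ((isBigO_rpow_second_difference_sub a).trans
    (isBigO_rpow_rpow_atTop (by linarith : a - 4 ≤ a - 2))).add
    ((isBigO_refl (fun x : ℝ => x ^ (a - 2)) atTop).const_mul_left (a * (a - 1)))
  exact h.congr_left fun x => by ring

/-- The truncated asymptotic series of the recurrence coefficients. -/
noncomputable def freudApprox (t x : ℝ) : ℝ :=
  x ^ (1 / 2 : ℝ) / (2 * √3)
    + t / 12
    + t ^ 2 / (48 * √3 * x ^ (1 / 2 : ℝ))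
    - (t ^ 4 - 48) / (2304 * √3 * x ^ (3 / 2 : ℝ))
    + t / (288 * x ^ 2)
    + t ^ 2 * (t ^ 4 - 144) / (55296 * √3 * x ^ (5 / 2 : ℝ))
    - t ^ 3 / (1728 * x ^ 3)

lemma freudApprox_eq_sum_rpow (t : ℝ) {x : ℝ} (hx : 0 ≤ x) :
    freudApprox t x = 1 / (2 * √3) * x ^ (1 / 2 : ℝ) + t / 12
      + t ^ 2 / (48 * √3) * x ^ (-(1 / 2) : ℝ)
      + -((t ^ 4 - 48) / (2304 * √3)) * x ^ (-(3 / 2) : ℝ)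
      + t / 288 * x ^ (-2 : ℝ)
      + t ^ 2 * (t ^ 4 - 144) / (55296 * √3) * x ^ (-(5 / 2) : ℝ)
      + -(t ^ 3 / 1728) * x ^ (-3 : ℝ) := by
  have h2 : x ^ (2 : ℝ) = x ^ 2 := by norm_cast
  have h3 : x ^ (3 : ℝ) = x ^ 3 := by norm_cast
  simp only [freudApprox, Real.rpow_neg hx, h2, h3, div_eq_mul_inv, mul_inv]
  ring

/-- In `y = x^(-1/2)` the series is a Laurent polynomial, so identities about it become ring
identities. -/
lemma freudApprox_eq_of_inv_sqrt (t : ℝ) {x y : ℝ} (hy : 0 < y) (hx : x = (y ^ 2)⁻¹) :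
    freudApprox t x = y⁻¹ / (2 * √3) + t / 12 + t ^ 2 / (48 * √3) * y
      - (t ^ 4 - 48) / (2304 * √3) * y ^ 3 + t / 288 * y ^ 4
      + t ^ 2 * (t ^ 4 - 144) / (55296 * √3) * y ^ 5 - t ^ 3 / 1728 * y ^ 6 := by
  have hyi : x = y⁻¹ ^ 2 := by rw [hx, inv_pow]
  have hpow : ∀ k : ℕ, x ^ ((k : ℝ) / 2) = y⁻¹ ^ k := fun k => by
    rw [hyi, ← Real.rpow_natCast, ← Real.rpow_mul (by positivity), ← Real.rpow_natCast]
    congr 1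
    push_cast
    ring
  have h1 := hpow 1
  have h3 := hpow 3
  have h5 := hpow 5
  norm_num at h1 h3 h5
  rw [freudApprox, h1, h3, h5, hx]
  field_simp

/-- Only `x^(1/2)` and `x^(-1/2)` contribute explicit terms: the constant drops out, and exponents
at most `-3/2` already have second differences `O(x^(-7/2))`. -/
lemma isBigO_freudApprox_second_difference (t : ℝ) :
    (fun x : ℝ => freudApprox t (x + 1) + freudApprox t (x - 1) - 2 * freudApprox t x
      - (-(1 / (8 * √3)) * x ^ (-(3 / 2) : ℝ) + t ^ 2 / (64 * √3) * x ^ (-(5 / 2) : ℝ)))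
      =O[atTop] fun x => x ^ (-(7 / 2) : ℝ) := by
  have h4 : ∀ (c a : ℝ), a - 4 ≤ -(7 / 2) → (fun x : ℝ => c * ((x + 1) ^ a + (x - 1) ^ a - 2 * x ^ a
      - a * (a - 1) * x ^ (a - 2))) =O[atTop] fun x => x ^ (-(7 / 2) : ℝ) := fun c a ha =>
    ((isBigO_rpow_second_difference_sub a).trans (isBigO_rpow_rpow_atTop ha)).const_mul_left c
  have h2 : ∀ (c a : ℝ), a - 2 ≤ -(7 / 2) →
      (fun x : ℝ => c * ((x + 1) ^ a + (x - 1) ^ a - 2 * x ^ a))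
      =O[atTop] fun x => x ^ (-(7 / 2) : ℝ) := fun c a ha =>
    ((isBigO_rpow_second_difference a).trans (isBigO_rpow_rpow_atTop ha)).const_mul_left c
  have h := (((((h4 (1 / (2 * √3)) (1 / 2) (by norm_num)).add
    (h4 (t ^ 2 / (48 * √3)) (-(1 / 2)) (by norm_num))).add
    (h2 (-((t ^ 4 - 48) / (2304 * √3))) (-(3 / 2)) (by norm_num))).add
    (h2 (t / 288) (-2) (by norm_num))).add
    (h2 (t ^ 2 * (t ^ 4 - 144) / (55296 * √3)) (-(5 / 2)) (by norm_num))).add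
    (h2 (-(t ^ 3 / 1728)) (-3) (by norm_num))
  refine h.congr' ?_ EventuallyEq.rfl
  filter_upwards [eventually_ge_atTop 1] with x hx
  rw [freudApprox_eq_sum_rpow t (by linarith : 0 ≤ x + 1),
    freudApprox_eq_sum_rpow t (by linarith : 0 ≤ x - 1),
    freudApprox_eq_sum_rpow t (by linarith : 0 ≤ x),
    show (1 / 2 - 2 : ℝ) = -(3 / 2) by norm_num, show (-(1 / 2) - 2 : ℝ) = -(5 / 2) by norm_num]
  ring

lemma tendsto_rpow_neg_half : Tendsto (fun x : ℝ => x ^ (-(1 / 2) : ℝ)) atTop (𝓝 0) :=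
  tendsto_rpow_neg_atTop (by norm_num)

lemma rpow_neg_half_pow {x : ℝ} (hx : 0 < x) (k : ℕ) :
    (x ^ (-(1 / 2) : ℝ)) ^ k = x ^ (-(k / 2) : ℝ) := by
  rw [← Real.rpow_natCast, ← Real.rpow_mul hx.le]
  congr 1
  ring

lemma eq_inv_rpow_neg_half_sq {x : ℝ} (hx : 0 < x) : x = ((x ^ (-(1 / 2) : ℝ)) ^ 2)⁻¹ := by
  rw [rpow_neg_half_pow hx, ← Real.rpow_neg hx.le]
  norm_num

lemma tendsto_freudApprox_div_sqrt (t : ℝ) :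
    Tendsto (fun x : ℝ => freudApprox t x / √x) atTop (𝓝 (1 / √12)) := by
  have hcont : Continuous fun y : ℝ => 1 / (2 * √3) + t / 12 * y + t ^ 2 / (48 * √3) * y ^ 2
      - (t ^ 4 - 48) / (2304 * √3) * y ^ 4 + t / 288 * y ^ 5
      + t ^ 2 * (t ^ 4 - 144) / (55296 * √3) * y ^ 6 - t ^ 3 / 1728 * y ^ 7 := by fun_prop
  have h := (hcont.tendsto 0).comp tendsto_rpow_neg_half
  have h12 : √12 = 2 * √3 := by
    rw [show (12 : ℝ) = 2 ^ 2 * 3 by norm_num, Real.sqrt_mul (by norm_num),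
      Real.sqrt_sq (by norm_num)]
  norm_num at h
  rw [h12]
  refine (h.congr' ?_).trans (by norm_num)
  filter_upwards [eventually_gt_atTop 0] with x hx
  have hy : 0 < x ^ (-(1 / 2) : ℝ) := by positivity
  have hsq : √x = (x ^ (-(1 / 2) : ℝ))⁻¹ := by
    rw [Real.rpow_neg hx.le, inv_inv, Real.sqrt_eq_rpow]
  rw [freudApprox_eq_of_inv_sqrt t hy (eq_inv_rpow_neg_half_sq hx), hsq]
  norm_num [Function.comp]
  set y := x ^ (-(1 / 2) : ℝ)
  field_simp

/-- The residual of the truncated series in the string equation. -/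
lemma isBigO_freudApprox_residual (t : ℝ) :
    (fun x : ℝ => 4 * freudApprox t x * (freudApprox t (x - 1) + freudApprox t x
      + freudApprox t (x + 1)) - 2 * t * freudApprox t x - x)
      =O[atTop] fun x => x ^ (-3 : ℝ) := by
  have hmain : (fun x : ℝ => 4 * freudApprox t x * (3 * freudApprox t x +
      (-(1 / (8 * √3)) * x ^ (-(3 / 2) : ℝ) + t ^ 2 / (64 * √3) * x ^ (-(5 / 2) : ℝ)) - t / 2) - x)
      =O[atTop] fun x => x ^ (-3 : ℝ) := by
    -- This polynomial is the exact quotient of the algebraic residual by `y⁶ = x⁻³`.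
    have hcont : Continuous fun y : ℝ => (-1/576) + (5/1327104) * t ^ 8
        + (-1/9216) * t ^ 5 * √3 * y + ((1/1728) * t ^ 2 + (-1/15925248) * t ^ 10) * y ^ 2
        + (5/1990656) * t ^ 7 * √3 * y ^ 3
        + ((-25/331776) * t ^ 4 + (1/764411904) * t ^ 12) * y ^ 4
        + (-1/11943936) * t ^ 9 * √3 * y ^ 5 + (1/248832) * t ^ 6 * y ^ 6 := by fun_prop
    have h := (isBigO_refl (fun x : ℝ => x ^ (-3 : ℝ)) atTop).mul
      (((hcont.tendsto 0).comp tendsto_rpow_neg_half).isBigO_one ℝ)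
    refine h.congr' ?_ (.of_forall fun x => mul_one _)
    filter_upwards [eventually_gt_atTop 0] with x hx
    have hy : 0 < x ^ (-(1 / 2) : ℝ) := by positivity
    have h3 := rpow_neg_half_pow hx 3
    have h5 := rpow_neg_half_pow hx 5
    have h6 := rpow_neg_half_pow hx 6
    have hxy := eq_inv_rpow_neg_half_sq hx
    have hr : √3 ^ 2 = (3 : ℝ) := Real.sq_sqrt (by norm_num)
    have hri : (√3)⁻¹ = √3 / 3 := by field_simp; linarith
    rw [freudApprox_eq_of_inv_sqrt t hy hxy]
    norm_num at h3 h5 h6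
    norm_num [Function.comp] at hxy ⊢
    rw [← h3, ← h5, ← h6]
    set y := x ^ (-(1 / 2) : ℝ)
    rw [hxy]
    simp only [div_eq_mul_inv, mul_inv, hri]
    set B := y⁻¹ / 6 + t ^ 2 / 144 * y - (t ^ 4 - 48) / 6912 * y ^ 3
      + t ^ 2 * (t ^ 4 - 144) / 165888 * y ^ 5 with hB
    set D := -y ^ 3 / 24 + t ^ 2 / 192 * y ^ 5 with hD
    -- `√3 B` and `√3 D` are the parts carrying `√3`; this is the correction that replaces `√3 ^ 2`
    -- by `3` in their product, leaving a ring identity.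
    have hz : 4 * B * (3 * B + D) * (√3 ^ 2 - 3) = 0 := by rw [hr]; ring
    rw [← sub_eq_zero]
    refine Eq.trans ?_ (neg_eq_zero.2 hz)
    rw [hB, hD]
    field_simp
    ring
  have hO : (freudApprox t) =O[atTop] fun x : ℝ => x ^ (1 / 2 : ℝ) := by
    have h := ((tendsto_freudApprox_div_sqrt t).isBigO_one ℝ).mul
      (isBigO_refl (fun x : ℝ => √x) atTop)
    refine h.congr' ?_ (.of_forall fun x => by simp only [one_mul, Real.sqrt_eq_rpow])
    filter_upwards [eventually_gt_atTop 0] with x hx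
    rw [div_mul_cancel₀]
    positivity
  have herr := (hO.const_mul_left 4).mul (isBigO_freudApprox_second_difference t)
  refine (hmain.add (herr.congr' EventuallyEq.rfl ?_)).congr_left fun x => by ring
  filter_upwards [eventually_gt_atTop 0] with x hx
  rw [← Real.rpow_add hx]
  norm_num

theorem theorem1 (t : ℝ) :
    (∃! β : ℕ → ℝ, IsFreudRecurrenceCoeff t β) ∧
    ∀ β : ℕ → ℝ, IsFreudRecurrenceCoeff t β →
      (fun n : ℕ => β n -
        ((n : ℝ) ^ (1 / 2 : ℝ) / (2 * √3)
          + t / 12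
          + t ^ 2 / (48 * √3 * (n : ℝ) ^ (1 / 2 : ℝ))
          - (t ^ 4 - 48) / (2304 * √3 * (n : ℝ) ^ (3 / 2 : ℝ))
          + t / (288 * (n : ℝ) ^ 2)
          + t ^ 2 * (t ^ 4 - 144) / (55296 * √3 * (n : ℝ) ^ (5 / 2 : ℝ))
          - t ^ 3 / (1728 * (n : ℝ) ^ 3)))
        =O[atTop] (fun n : ℕ => (n : ℝ) ^ (-(7 / 2) : ℝ)) := by
  refine ⟨⟨freudCoeff t, isFreudRecurrenceCoeff_freudCoeff t,
    fun γ hγ => hγ.unique (isFreudRecurrenceCoeff_freudCoeff t)⟩, fun β hβ => ?_⟩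
  have hb0 : β 0 = 0 := by obtain ⟨P, -, h, -⟩ := hβ; exact h
  have hs := fun n => (hβ.pos_and_string_equation n).2
  -- Here `a = 7/2`, so the required residual order `1/2 - a` is `-3`, taken at `x = n + 1`.
  refine isBigO_sub_of_string_equation_residual (t := t) (f := fun n : ℕ => freudApprox t n)
    (by norm_num) hs
    (tendsto_div_sqrt_of_string_equation hb0 (fun n => (hβ.pos_and_string_equation n).1) hs)
    ((tendsto_freudApprox_div_sqrt t).comp tendsto_natCast_atTop_atTop) ?_
  have hshift : Tendsto (fun n : ℕ => (n : ℝ) + 1) atTop atTop :=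
    tendsto_atTop_add_const_right _ _ tendsto_natCast_atTop_atTop
  refine ((isBigO_freudApprox_residual t).comp_tendsto hshift).congr (fun n => ?_) fun n => ?_
  · simp only [Function.comp]
    push_cast
    rw [add_sub_cancel_right, add_assoc (n : ℝ) 1 1, one_add_one_eq_two]
  · simp only [Function.comp]
    norm_num
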